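/- Let $S$ be a polynomial ring in finitely many variables over a field $k$, and let $M\subsetneq S$ be a proper monomial ideal with minimal generating set of monomials $G$. A monomial $a\in G$ is called dominant (in $G$) if there is a variable $x$ whose exponent in $a$ is larger than its exponent in every other element of $G$. Let $D=\{m_1,\ldots,m_d\}\subseteq G$ be a set of dominant elements of $G$, and let $\{h_1,\ldots,h_c\}=G\setminus D$. Let $m=\operatorname{lcm}(m_{r_1},\ldots,m_{r_j})$, where $1\le r_1<\cdots<r_j\le d$ (with $m=1$ if $j=0$), and let $M_m=(h_1',\ldots,h_c')$, where $h_s'=\operatorname{lcm}(m,h_s)/m$. For monomials $l_1,\ldots,l_q$, the Taylor resolution $\mathbb T_{l_1,\ldots,l_q}$ of $S/(l_1,\ldots,l_q)$ has as basis in homological degree $s$ the symbols $[l_{i_1},\ldots,l_{i_s}]$ with $1\le i_1<\cdots<i_s\le q$, of multidegree $\operatorname{lcm}(l_{i_1},\ldots,l_{i_s})$, and differential $$[l_{i_1},\ldots,l_{i_s}]\mapsto\sum_{t=1}^s(-1)^{t+1}\frac{\operatorname{lcm}(l_{i_1},\ldots,l_{i_s})}{\operatorname{lcm}(l_{i_1},\ldots,\widehat{l_{i_t}},\ldots,l_{i_s})}[l_{i_1},\ldots,\widehat{l_{i_t}},\ldots,l_{i_s}].$$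 Let $\mathbb T_{M_m}$ be the Taylor resolution of $S/M_m$ determined by the minimal generating set of $M_m$, and let $m'$ be a monomial that is the multidegree of some basis element of $\mathbb T_{M_m}$. Let $\mathbb F$ be a minimal free resolution of $S/M_m$ and $\mathbb G$ a minimal free resolution of $S/M$ (multigraded free resolutions with bases whose elements have monomials as multidegrees, such that no differential matrix $F_i\to F_{i-1}$, $i\ge 1$, has an invertible entry). Then: (i) There are no basis elements of $\mathbb G$ with multidegree $mm'$ and homological degree less than $j$. (ii) For each $i\ge 0$, there is a bijective correspondence between the basis elements of $\mathbb F$ with multidegree $m'$ and homological degree $i$, and the basis elements of $\mathbb G$ with multidegree $mm'$ and homological degree $i+j$. -/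

import Mathlib

/-!
Monomials of the polynomial ring `S = k[x_s : s ∈ σ]` are represented by their exponent vectors
`a : σ →₀ ℕ`: the product of monomials is `+`, the monomial `1` is `0`, divisibility is `≤`,
the least common multiple is `⊔`, and an exact quotient of monomials is `-`.
-/

namespace MonomialResolution

open MvPolynomial

universe u v w

/-- The ideal of `S` generated by a set `A` of monomials. -/
noncomputable def monomialIdeal (k : Type u) [Field k] {σ : Type v} (A : Set (σ →₀ ℕ)) :
    Ideal (MvPolynomial σ k) :=
  Ideal.span ((fun a => monomial a (1 : k)) '' A)

/-- `G` is a minimal generating set, made of monomials, of the (monomial) ideal `M`: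
`G` generates `M`, and no proper subset of `G` does. -/
def IsMinGenSet (k : Type u) [Field k] {σ : Type v} (G : Set (σ →₀ ℕ))
    (M : Ideal (MvPolynomial σ k)) : Prop :=
  monomialIdeal k G = M ∧ ∀ G' : Set (σ →₀ ℕ), G' ⊂ G → monomialIdeal k G' ≠ M

/-- The monomial `a` is a dominant element of `G`: some variable `x` appears in `a` with a larger
exponent than in any other element of `G`. -/
def IsDominantIn {σ : Type v} (G : Set (σ →₀ ℕ)) (a : σ →₀ ℕ) : Prop :=
  a ∈ G ∧ ∃ x : σ, ∀ b ∈ G, b ≠ a → b x < a x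

/-- The ideal `M_m = (lcm(m,h)/m : h ∈ H)`. -/
noncomputable def lcmQuotientIdeal (k : Type u) [Field k] {σ : Type v} (m : σ →₀ ℕ) (H : Set (σ →₀ ℕ)) :
    Ideal (MvPolynomial σ k) :=
  monomialIdeal k ((fun h => (m ⊔ h) - m) '' H)

/-- A sequence `⋯ → F₂ → F₁ → F₀ → S/M` of free `S`-modules `F_i` with chosen bases, whose basis
elements carry multidegrees (monomials), and of multigraded (degree preserving) `S`-linear maps.
Being a resolution, or a minimal one, is a property of such a sequence. -/
structure MultigradedFreeSeq {k : Type u} [Field k] {σ : Type v}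
    (M : Ideal (MvPolynomial σ k)) where
  /-- the basis of `F_i` -/
  basis : ℕ → Type w
  /-- the multidegree of a basis element of `F_i` -/
  mdeg : ∀ i, basis i → (σ →₀ ℕ)
  /-- the differential `F_{i+1} → F_i` -/
  d : ∀ i, (basis (i + 1) →₀ MvPolynomial σ k) →ₗ[MvPolynomial σ k] (basis i →₀ MvPolynomial σ k)
  /-- the augmentation `F_0 → S/M` -/
  aug : (basis 0 →₀ MvPolynomial σ k) →ₗ[MvPolynomial σ k] (MvPolynomial σ k ⧸ M)
  /-- the entry of `d i` in column `b` and row `c` is a scalar multiple of the monomial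
  `mdeg b / mdeg c` (hence `0` if `mdeg c` does not divide `mdeg b`) -/
  d_homogeneous : ∀ i (b : basis (i + 1)) (c : basis i),
    ∀ e ∈ (d i (Finsupp.single b 1) c).support, e + mdeg i c = mdeg (i + 1) b
  /-- a basis element `b` of `F_0` is sent to the class of a scalar multiple of `mdeg b` -/
  aug_homogeneous : ∀ b : basis 0, ∃ a : k,
    aug (Finsupp.single b 1) = Ideal.Quotient.mk M (monomial (mdeg 0 b) a)

namespace MultigradedFreeSeq

variable {k : Type u} [Field k] {σ : Type v} {M : Ideal (MvPolynomial σ k)}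

/-- The entry of the matrix of the differential `F_{i+1} → F_i` in column `b` and row `c`. -/
noncomputable def entry (F : MultigradedFreeSeq.{u, v, w} M) (i : ℕ) (b : F.basis (i + 1)) (c : F.basis i) :
    MvPolynomial σ k :=
  F.d i (Finsupp.single b 1) c

/-- `⋯ → F₂ → F₁ → F₀ → S/M → 0` is exact, i.e. `F` is a (multigraded) free resolution of
`S/M`. -/
def IsResolution (F : MultigradedFreeSeq.{u, v, w} M) : Prop :=
  Function.Surjective F.aug ∧ Function.Exact (F.d 0) F.aug ∧
    ∀ i, Function.Exact (F.d (i + 1)) (F.d i)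

/-- `F` is a minimal free resolution of `S/M`: a free resolution none of whose differential
matrices has an invertible entry. -/
def IsMinimalResolution (F : MultigradedFreeSeq.{u, v, w} M) : Prop :=
  F.IsResolution ∧ ∀ i (b : F.basis (i + 1)) (c : F.basis i), ¬ IsUnit (F.entry i b c)

/-- The set (as a type) of basis elements of homological degree `i` and multidegree `l`. -/
abbrev basisOfDegree (F : MultigradedFreeSeq.{u, v, w} M) (i : ℕ) (l : σ →₀ ℕ) : Type w :=
  {b : F.basis i // F.mdeg i b = l}

/-- The monomial `l` occurs in `F`: some basis element of `F` has multidegree `l`. -/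
def Occurs (F : MultigradedFreeSeq.{u, v, w} M) (l : σ →₀ ℕ) : Prop :=
  ∃ i, Nonempty (F.basisOfDegree i l)

end MultigradedFreeSeq

/-- The Taylor symbols `[l_{i_1}, …, l_{i_s}]` of homological degree `s`, as sets of indices. -/
abbrev TaylorSymbol (q s : ℕ) : Type := {U : Finset (Fin q) // U.card = s}

/-- The facet of a Taylor symbol obtained by omitting one of its elements. -/
def TaylorSymbol.facet {q s : ℕ} (U : TaylorSymbol q (s + 1)) (j : {j // j ∈ U.1}) :
    TaylorSymbol q s :=
  ⟨U.1.erase j.1, by rw [Finset.card_erase_of_mem j.2, U.2]; rfl⟩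

/-- The Taylor differential of a Taylor symbol: the signed sum of its facets, each with
coefficient the quotient of the least common multiples; the sign of the facet omitting `l_j` is
`(-1)` to the number of elements of the symbol that precede `l_j`. -/
noncomputable def taylorD (k : Type u) [Field k] {σ : Type v} {q : ℕ} (l : Fin q → (σ →₀ ℕ))
    {s : ℕ} (U : TaylorSymbol q (s + 1)) : TaylorSymbol q s →₀ MvPolynomial σ k :=
  ∑ j : {j // j ∈ U.1}, Finsupp.single (U.facet j)
    (monomial (U.1.sup l - (U.facet j).1.sup l) ((-1 : k) ^ (U.1.filter (· < j.1)).card))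

/-- The Taylor resolution of `S/(l_1, …, l_q)` determined by the monomials `l_1, …, l_q`. -/
noncomputable def taylor (k : Type u) [Field k] {σ : Type v} {q : ℕ} (l : Fin q → (σ →₀ ℕ)) :
    MultigradedFreeSeq.{u, v, 0} (monomialIdeal k (Set.range l)) where
  basis s := TaylorSymbol q s
  mdeg _ U := U.1.sup l
  d _ := Finsupp.linearCombination (MvPolynomial σ k) (taylorD k l)
  aug := Finsupp.linearCombination (MvPolynomial σ k) (fun _ => 1)
  d_homogeneous := by
    classical
    intro i b c e he
    rw [Finsupp.linearCombination_single, one_smul, taylorD, Finsupp.finsetSum_apply] at he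
    obtain ⟨j, _, hj⟩ := Finset.mem_biUnion.1 (support_sum he)
    rw [Finsupp.single_apply] at hj
    split_ifs at hj with h
    · subst h
      have := support_monomial_subset hj
      rw [Finset.mem_singleton] at this
      subst this
      exact tsub_add_cancel_of_le (Finset.sup_mono (Finset.erase_subset _ _))
    · simp at hj
  aug_homogeneous := by
    intro b
    refine ⟨1, ?_⟩
    have hb : b.1 = ∅ := Finset.card_eq_zero.1 b.2
    rw [Finsupp.linearCombination_single, one_smul, hb, Finset.sup_empty]
    rfl

end MonomialResolution

namespace MonomialResolution

universe u v w

/-! Setting all variables to 1 turns a multigraded resolution of S/M into a complex C of vector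
spaces filtered by multidegree. Its part C≤u is the strand of multidegree u: acyclic if u lies in M,
with homology k in degree 0 otherwise. Minimality says that the differential strictly lowers
multidegrees.

Let r in R be dominant at the variable x, with exponent e there. For u of exponent e at x, and u'
obtained from u by lowering that exponent to e - 1, the basis elements of exponent exactly e compute
C≤u / C≤u'. Passing from u to u' destroys divisibility by r and by no other generator. The long
exact sequence therefore moves the homology up one degree, and it survives exactly where r divides u
and no other generator does (`IsResolving.face`). Doing this for every r in R gives a minimal
complex with homology only in degree j, at those u divisible by m and by no generator outside R
(`exists_dominantFace`).

The exponents of mm' come from R and G \ D, so no element of D \ R divides mm'. Hence, for u below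
mm' in the face, the condition becomes: m divides u and u/m is not in M_m. This is the homology of
the resolution of S/M_m with degrees multiplied by m. Minimal filtered complexes with the same
homology have equally many basis elements in each degree (`nonempty_equiv_of_isResolving`), which
gives (ii). Minimality and the absence of homology below degree j give (i). -/

/-- A complex of `k`-vector spaces with chosen bases, whose basis elements carry degrees in a
preordered set, such that the differential does not increase degrees. -/
structure FilteredComplex (k : Type u) [Field k] (Λ : Type v) [Preorder Λ] where
  /-- the basis in homological degree `i` -/
  B : ℕ → Type w
  /-- the degree of a basis element -/
  deg : ∀ i, B i → Λ
  /-- the differential -/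
  D : ∀ i, (B (i + 1) →₀ k) →ₗ[k] (B i →₀ k)
  D_le : ∀ i b, D i (Finsupp.single b 1) ∈ Finsupp.supported k k {c | deg i c ≤ deg (i + 1) b}
  D_comp : ∀ i z, D i (D (i + 1) z) = 0

/-! ### Linear maps on spans of basis elements -/

theorem map_mem_of_forall_single {k : Type*} [Field k] {α V : Type*} [AddCommGroup V] [Module k V]
    {s : Set α} {N : Submodule k V} (f : (α →₀ k) →ₗ[k] V)
    (h : ∀ a ∈ s, f (Finsupp.single a 1) ∈ N) {z : α →₀ k} (hz : z ∈ Finsupp.supported k k s) :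
    f z ∈ N := by
  rw [Finsupp.supported_eq_span_single] at hz
  have : Submodule.span k ((fun i => Finsupp.single i (1 : k)) '' s) ≤ N.comap f := by
    rw [Submodule.span_le]
    rintro _ ⟨a, ha, rfl⟩
    exact h a ha
  exact this hz

theorem map_eq_of_forall_single {k : Type*} [Field k] {α V : Type*} [AddCommGroup V] [Module k V]
    {s : Set α} (f g : (α →₀ k) →ₗ[k] V)
    (h : ∀ a ∈ s, f (Finsupp.single a 1) = g (Finsupp.single a 1)) {z : α →₀ k}
    (hz : z ∈ Finsupp.supported k k s) : f z = g z := by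
  have := map_mem_of_forall_single (N := ⊥) (f - g)
    (fun a ha => by simp [h a ha]) hz
  simpa [sub_eq_zero] using this

section Subtype

variable (k : Type*) [Field k] {α : Type*} (p : α → Prop)

/-- The inclusion of the span of the basis elements satisfying `p`. -/
noncomputable def extendₗ : ({a // p a} →₀ k) →ₗ[k] (α →₀ k) :=
  Finsupp.lmapDomain k k Subtype.val

/-- The projection onto the span of the basis elements satisfying `p`. -/
noncomputable def restrictₗ : (α →₀ k) →ₗ[k] ({a // p a} →₀ k) :=
  Finsupp.lsubtypeDomain {a | p a}

variable {k p}

@[simp]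
theorem extendₗ_single (a : {a // p a}) (x : k) :
    extendₗ k p (Finsupp.single a x) = Finsupp.single a.1 x := by
  simp [extendₗ, Finsupp.lmapDomain_apply, Finsupp.mapDomain_single]

theorem extendₗ_apply (z : {a // p a} →₀ k) (a : {a // p a}) : extendₗ k p z a.1 = z a :=
  Finsupp.mapDomain_apply Subtype.val_injective z a

@[simp]
theorem restrictₗ_extendₗ (z : {a // p a} →₀ k) : restrictₗ k p (extendₗ k p z) = z := by
  ext a
  exact extendₗ_apply z a

theorem extendₗ_mem_supported {s : Set α} {z : {a // p a} →₀ k}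
    (hz : z ∈ Finsupp.supported k k {a : {a // p a} | a.1 ∈ s}) :
    extendₗ k p z ∈ Finsupp.supported k k s :=
  map_mem_of_forall_single (extendₗ k p)
    (fun a ha => by rw [extendₗ_single]; exact Finsupp.single_mem_supported k 1 ha) hz

theorem restrictₗ_mem_supported {s : Set α} {z : α →₀ k} (hz : z ∈ Finsupp.supported k k s) :
    restrictₗ k p z ∈ Finsupp.supported k k {a : {a // p a} | a.1 ∈ s} := by
  rw [Finsupp.mem_supported'] at hz ⊢
  exact fun a ha => hz a.1 ha

theorem restrictₗ_eq_zero {s : Set α} (hs : ∀ a ∈ s, ¬ p a) {z : α →₀ k}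
    (hz : z ∈ Finsupp.supported k k s) : restrictₗ k p z = 0 := by
  ext a
  exact (Finsupp.mem_supported' k z).1 hz a.1 fun h => hs _ h a.2

theorem mem_supported_of_restrictₗ_eq_zero {s : Set α} {z : α →₀ k}
    (hz : z ∈ Finsupp.supported k k s) (h : restrictₗ k p z = 0) :
    z ∈ Finsupp.supported k k {a | a ∈ s ∧ ¬ p a} := by
  rw [Finsupp.mem_supported'] at hz ⊢
  intro a ha
  by_cases hs : a ∈ s
  · have hp : p a := by by_contra hp; exact ha ⟨hs, hp⟩
    exact DFunLike.congr_fun h ⟨a, hp⟩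
  · exact hz a hs

end Subtype

/-! ### Filtered complexes: minimality, homology of strands, restriction -/

namespace FilteredComplex

variable {k : Type u} [Field k] {Λ : Type v}

section Preorder

variable [Preorder Λ] (C : FilteredComplex.{u, v, w} k Λ)

/-- The span of the basis elements of degree at most `u`. -/
abbrev below (i : ℕ) (u : Λ) : Submodule k (C.B i →₀ k) :=
  Finsupp.supported k k {b | C.deg i b ≤ u}

/-- The span of the basis elements of degree less than `u`. -/
abbrev strictlyBelow (i : ℕ) (u : Λ) : Submodule k (C.B i →₀ k) :=
  Finsupp.supported k k {b | C.deg i b < u}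

/-- The cycles of homological degree `i`. -/
noncomputable def cycles : ∀ i, Submodule k (C.B i →₀ k)
  | 0 => ⊤
  | i + 1 => LinearMap.ker (C.D i)

/-- No coefficient of the differential links two basis elements of the same degree. -/
def IsMinimal : Prop :=
  ∀ i b c, C.deg i c = C.deg (i + 1) b → C.D i (Finsupp.single b 1) c = 0

/-- For `u ∈ adm` the homology of the part of `C` of degree at most `u` is zero, except that, for
`u ∉ J`, it is mapped isomorphically to `k` by `ε n` in homological degree `n`. -/
structure IsResolving (n : ℕ) (adm J : Set Λ) (ε : ∀ i, (C.B i →₀ k) →ₗ[k] k) : Prop where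
  exact : ∀ i, ∀ u ∈ adm, ∀ z ∈ C.below i u, z ∈ C.cycles i → (i = n → u ∈ J ∨ ε i z = 0) →
    ∃ y ∈ C.below (i + 1) u, C.D i y = z
  aug_D : ∀ u ∈ adm, u ∉ J → ∀ z ∈ C.below (n + 1) u, ε n (C.D n z) = 0
  surj : ∀ u ∈ adm, u ∉ J → ∃ z ∈ C.below n u, z ∈ C.cycles n ∧ ε n z = 1

variable {C}

theorem below_mono {i : ℕ} {u v : Λ} (h : u ≤ v) : C.below i u ≤ C.below i v :=
  Finsupp.supported_mono fun _ hb => le_trans hb h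

theorem single_mem_below {i : ℕ} {b : C.B i} {u : Λ} (h : C.deg i b ≤ u) (a : k) :
    Finsupp.single b a ∈ C.below i u :=
  Finsupp.single_mem_supported k a h

theorem D_mem_below {i : ℕ} {u : Λ} {z : C.B (i + 1) →₀ k} (hz : z ∈ C.below (i + 1) u) :
    C.D i z ∈ C.below i u :=
  map_mem_of_forall_single (C.D i) (fun b hb => C.below_mono hb (C.D_le i b)) hz

theorem D_mem_cycles (i : ℕ) (z : C.B (i + 1) →₀ k) : C.D i z ∈ C.cycles i := by
  cases i with
  | zero => trivial
  | succ i => exact C.D_comp i z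

theorem IsResolving.congr {n : ℕ} {adm adm' J J' : Set Λ} {ε : ∀ i, (C.B i →₀ k) →ₗ[k] k}
    (h : C.IsResolving n adm J ε) (hadm : adm' ⊆ adm) (hJ : ∀ u ∈ adm', u ∈ J' ↔ u ∈ J) :
    C.IsResolving n adm' J' ε where
  exact i u hu z hz hc hi := h.exact i u (hadm hu) z hz hc fun e => by
    rw [← hJ u hu]; exact hi e
  aug_D u hu hJu := h.aug_D u (hadm hu) (by rwa [← hJ u hu])
  surj u hu hJu := h.surj u (hadm hu) (by rwa [← hJ u hu])

variable (C)

/-- The complex spanned by the basis elements of homological degree at least `n`. -/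
noncomputable def shift (n : ℕ) : FilteredComplex.{u, v, w} k Λ where
  B i := C.B (n + i)
  deg i := C.deg (n + i)
  D i := C.D (n + i)
  D_le i := C.D_le (n + i)
  D_comp i := C.D_comp (n + i)

variable {C}

theorem IsMinimal.shift (h : C.IsMinimal) (n : ℕ) : (C.shift n).IsMinimal :=
  fun i => h (n + i)

theorem IsResolving.shift {n : ℕ} {adm J : Set Λ} {ε : ∀ i, (C.B i →₀ k) →ₗ[k] k}
    (h : C.IsResolving n adm J ε) (hn : C.cycles n = ⊤) :
    (C.shift n).IsResolving 0 adm J (fun i => ε (n + i)) where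
  exact i u hu z hz hc hi := by
    refine h.exact (n + i) u hu z hz ?_ fun e => hi (by omega)
    cases i with
    | zero => exact hn ▸ Submodule.mem_top
    | succ i => exact hc
  aug_D := h.aug_D
  surj u hu hJ := by
    obtain ⟨z, hz, -, h1⟩ := h.surj u hu hJ
    exact ⟨z, hz, trivial, h1⟩

variable (C)

/-- The restriction of a complex to the basis elements with degrees in a convex set. -/
noncomputable def restrict (s : Set Λ) (hs : s.OrdConnected) : FilteredComplex.{u, v, w} k Λ where
  B i := {b : C.B i // C.deg i b ∈ s}
  deg i b := C.deg i b.1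
  D i := restrictₗ k _ ∘ₗ C.D i ∘ₗ extendₗ k _
  D_le i b := by
    simpa using restrictₗ_mem_supported (C.D_le i b.1)
  D_comp i z := by
    set π := restrictₗ k (fun b : C.B (i + 1) => C.deg (i + 1) b ∈ s)
    set ι := extendₗ k (fun b : C.B (i + 1) => C.deg (i + 1) b ∈ s)
    -- By convexity, a component that leaves `s` under the differential cannot return to it, so
    -- discarding it does not affect the square of the differential.
    have key : ∀ y ∈ Finsupp.supported k k {b | C.deg (i + 2) b ∈ s},
        restrictₗ k (fun b : C.B i => C.deg i b ∈ s) (C.D i (ι (π (C.D (i + 1) y)))) = 0 := by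
      intro y hy
      refine (Submodule.mem_bot k).1 (map_mem_of_forall_single (N := ⊥)
        (restrictₗ k (fun b : C.B i => C.deg i b ∈ s) ∘ₗ C.D i ∘ₗ ι ∘ₗ π ∘ₗ C.D (i + 1)) ?_ hy)
      intro b hb
      set t := C.D (i + 1) (Finsupp.single b 1) with ht
      have h1 : t - ι (π t) ∈ C.below (i + 1) (C.deg (i + 2) b) :=
        sub_mem (C.D_le (i + 1) b)
          (extendₗ_mem_supported (restrictₗ_mem_supported (C.D_le (i + 1) b)))
      have h2 := mem_supported_of_restrictₗ_eq_zero (p := fun b => C.deg (i + 1) b ∈ s) h1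
          (by simp [π, ι])
      have h3 : C.D i (t - ι (π t)) ∈ Finsupp.supported k k {c | C.deg i c ∉ s} := by
        refine map_mem_of_forall_single _ ?_ h2
        rintro c ⟨hc, hcs⟩
        refine Finsupp.supported_mono ?_ (C.D_le i c)
        intro d hd hds
        exact hcs (hs.out hds hb ⟨hd, hc⟩)
      have h4 := restrictₗ_eq_zero (p := fun b : C.B i => C.deg i b ∈ s) (fun a ha => ha) h3
      rw [map_sub, map_sub, C.D_comp i, map_zero, zero_sub, neg_eq_zero] at h4
      simpa using h4
    refine key _ (extendₗ_mem_supported ?_)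
    rw [Finsupp.mem_supported]
    exact fun b _ => b.2

variable {C}

theorem IsMinimal.restrict (h : C.IsMinimal) (s : Set Λ) (hs : s.OrdConnected) :
    (C.restrict s hs).IsMinimal := by
  intro i b c hbc
  exact (congrArg (fun y => C.D i y c.1) (extendₗ_single (k := k) b 1)).trans (h i b.1 c.1 hbc)

end Preorder

section PartialOrder

variable [PartialOrder Λ] {C : FilteredComplex.{u, v, w} k Λ}

theorem IsMinimal.D_mem_strictlyBelow (h : C.IsMinimal) {i : ℕ} {u : Λ} {z : C.B (i + 1) →₀ k}
    (hz : z ∈ C.below (i + 1) u) : C.D i z ∈ C.strictlyBelow i u := by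
  refine map_mem_of_forall_single (C.D i) (fun b hb => ?_) hz
  rw [Finsupp.mem_supported']
  intro c hc
  by_contra h0
  have h1 : C.deg i c ≤ C.deg (i + 1) b := by
    by_contra h2
    exact h0 ((Finsupp.mem_supported' k _).1 (C.D_le i b) c h2)
  rcases h1.lt_or_eq with h2 | h2
  · exact hc (h2.trans_le hb)
  · exact h0 (h i b c h2)

/-- A basis element in the lowest nonzero degree is a cycle. If that degree is below `n` it bounds
inside its own strand, but by minimality boundaries there have strictly smaller multidegree. -/
theorem IsMinimal.isEmpty (h : C.IsMinimal) {n : ℕ} {adm J : Set Λ}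
    {ε : ∀ i, (C.B i →₀ k) →ₗ[k] k} (hC : C.IsResolving n adm J ε)
    (hadm : ∀ i b, C.deg i b ∈ adm) : ∀ i < n, IsEmpty (C.B i) := by
  have key : ∀ i < n, C.cycles i = ⊤ → IsEmpty (C.B i) := by
    intro i hi hc
    refine ⟨fun b => ?_⟩
    obtain ⟨y, hy, hy'⟩ := hC.exact i _ (hadm i b) (Finsupp.single b 1)
      (single_mem_below le_rfl 1) (hc ▸ Submodule.mem_top) (fun e => absurd e hi.ne)
    have := (Finsupp.mem_supported' k _).1 (h.D_mem_strictlyBelow hy) b (lt_irrefl _)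
    rw [hy'] at this
    simp at this
  intro i
  induction i with
  | zero => exact fun hi => key 0 hi rfl
  | succ i ih =>
    intro hi
    have := ih (by omega)
    refine key _ hi ?_
    rw [eq_top_iff]
    intro z _
    exact Subsingleton.elim _ _

theorem IsMinimal.cycles_eq_top (h : C.IsMinimal) {n : ℕ} {adm J : Set Λ}
    {ε : ∀ i, (C.B i →₀ k) →ₗ[k] k} (hC : C.IsResolving n adm J ε)
    (hadm : ∀ i b, C.deg i b ∈ adm) : C.cycles n = ⊤ := by
  cases n with
  | zero => rfl
  | succ n =>
    have := h.isEmpty hC hadm n (by omega)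
    rw [eq_top_iff]
    intro z _
    exact Subsingleton.elim _ _

end PartialOrder

/-! ### Faces and the long exact sequence -/

section Face

variable {σ : Type v} {C : FilteredComplex.{u, v, w} k (σ →₀ ℕ)}

theorem ordConnected_setOf_apply_eq (x : σ) (e : ℕ) : {v : σ →₀ ℕ | v x = e}.OrdConnected :=
  ⟨fun _ ha _ hb _ hc => le_antisymm ((hc.2 x).trans hb.le) (ha.ge.trans (hc.1 x))⟩

/-- The complex spanned by the basis elements whose degree has exponent `e` at `x`. -/
noncomputable abbrev face (C : FilteredComplex.{u, v, w} k (σ →₀ ℕ)) (x : σ) (e : ℕ) :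
    FilteredComplex.{u, v, w} k (σ →₀ ℕ) :=
  C.restrict _ (ordConnected_setOf_apply_eq x e)

theorem le_update_iff {u v : σ →₀ ℕ} {x : σ} {e : ℕ} (he : 1 ≤ e) (hu : u x = e) :
    v ≤ u.update x (e - 1) ↔ v ≤ u ∧ v x ≠ e := by
  classical
  constructor
  · intro h
    have hx := h x
    simp only [Finsupp.coe_update, Function.update_self] at hx
    refine ⟨fun y => ?_, by omega⟩
    by_cases hy : y = x
    · subst hy; omega
    · have := h y
      simpa [Function.update_of_ne hy] using this
  · rintro ⟨h, hx⟩ y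
    by_cases hy : y = x
    · subst hy
      have := h y
      simp only [Finsupp.coe_update, Function.update_self]
      omega
    · simpa [Function.update_of_ne hy] using h y

/-- Passing to the face `v x = e` raises the homological degree of the homology by one. -/
theorem IsResolving.face {n : ℕ} {adm J adm' J' : Set (σ →₀ ℕ)}
    {ε : ∀ i, (C.B i →₀ k) →ₗ[k] k} (h : C.IsResolving n adm J ε) {x : σ} {e : ℕ} (he : 1 ≤ e)
    (hadm : ∀ u ∈ adm', u x = e ∧ u ∈ adm ∧ u.update x (e - 1) ∈ adm)
    (hJ : ∀ u ∈ adm', (u ∈ J ∧ (u ∈ J' ↔ u.update x (e - 1) ∈ J)) ∨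
      (u ∉ J ∧ u.update x (e - 1) ∉ J ∧ u ∈ J')) :
    ∃ ε', (C.face x e).IsResolving (n + 1) adm' J' ε' := by
  -- In degree `n + 1` this is the connecting homomorphism followed by `ε n`.
  let ε' : ∀ i, ((C.face x e).B i →₀ k) →ₗ[k] k := fun i => match i with
    | 0 => 0
    | i + 1 => ε i ∘ₗ C.D i ∘ₗ extendₗ k _
  have hup : ∀ {i u}, u ∈ adm' → ∀ {z}, z ∈ C.below i u →
      restrictₗ k (fun b : C.B i => C.deg i b ∈ {v : σ →₀ ℕ | v x = e}) z = 0 →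
      z ∈ C.below i (u.update x (e - 1)) := by
    intro i u hu z hz h0
    refine Finsupp.supported_mono ?_ (mem_supported_of_restrictₗ_eq_zero hz h0)
    rintro b ⟨hb, hb'⟩
    exact (le_update_iff he (hadm u hu).1).2 ⟨hb, hb'⟩
  have hdown : ∀ {i u}, u ∈ adm' → ∀ {z}, z ∈ C.below i (u.update x (e - 1)) →
      restrictₗ k (fun b : C.B i => C.deg i b ∈ {v : σ →₀ ℕ | v x = e}) z = 0 := by
    intro i u hu z hz
    refine restrictₗ_eq_zero ?_ hz
    intro b hb
    exact ((le_update_iff he (hadm u hu).1).1 hb).2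
  have hle : ∀ {u}, u ∈ adm' → u.update x (e - 1) ≤ u := fun {u} hu =>
    ((le_update_iff he (hadm u hu).1).1 le_rfl).1
  -- decomposition of an element into its part in the face and its part below
  have hdec : ∀ {i u}, u ∈ adm' → ∀ {z}, z ∈ C.below i u →
      z - extendₗ k _ (restrictₗ k (fun b : C.B i => C.deg i b ∈ {v : σ →₀ ℕ | v x = e}) z) ∈
        C.below i (u.update x (e - 1)) := by
    intro i u hu z hz
    refine hup hu (sub_mem hz (extendₗ_mem_supported (restrictₗ_mem_supported hz))) (by simp)
  -- A face element whose lift bounds modulo the strand of `u.update x (e - 1)` bounds in the face,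
  -- the quotient by that strand.
  have hbd : ∀ {i u}, u ∈ adm' → ∀ {z : (C.face x e).B i →₀ k} {t},
      t ∈ C.below (i + 1) u → extendₗ k _ z - C.D i t ∈ C.below i (u.update x (e - 1)) →
      ∃ y ∈ (C.face x e).below (i + 1) u, (C.face x e).D i y = z := by
    intro i u hu z t ht hzt
    refine ⟨restrictₗ k _ t, restrictₗ_mem_supported ht, ?_⟩
    have h1 := hdown hu (D_mem_below (hdec hu ht))
    have h2 := hdown hu hzt
    rw [map_sub, map_sub, sub_eq_zero] at h1
    rw [map_sub, sub_eq_zero] at h2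
    exact h1.symm.trans (h2.symm.trans (restrictₗ_extendₗ z))
  -- Surjectivity in homology of the inclusion of the strand of `u.update x (e - 1)` into that of
  -- `u`. If the strand of `u` has a class, so has the smaller one, and a multiple of it corrects
  -- the cycle.
  have hcyc : ∀ {i u}, u ∈ adm' → ∀ {z}, z ∈ C.below i u → z ∈ C.cycles i →
      ∃ t ∈ C.below (i + 1) u, z - C.D i t ∈ C.below i (u.update x (e - 1)) := by
    intro i u hu z hz hc
    obtain ⟨hux, hua, hua'⟩ := hadm u hu
    by_cases hi : i = n → u ∈ J
    · obtain ⟨t, ht, rfl⟩ := h.exact i u hua z hz hc fun e => Or.inl (hi e)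
      exact ⟨t, ht, by simp⟩
    · push Not at hi
      obtain ⟨rfl, huJ⟩ := hi
      rcases hJ u hu with ⟨h1, -⟩ | ⟨-, h2, -⟩
      · exact absurd h1 huJ
      obtain ⟨c, hcu, hcc, hc1⟩ := h.surj _ hua' h2
      obtain ⟨t, ht, hzt⟩ := h.exact i u hua (z - ε i z • c)
        (sub_mem hz (Submodule.smul_mem _ _ (below_mono (hle hu) hcu)))
        (sub_mem hc (Submodule.smul_mem _ _ hcc)) fun _ => Or.inr (by simp [hc1])
      refine ⟨t, ht, ?_⟩
      rw [hzt, sub_sub_cancel]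
      exact Submodule.smul_mem _ _ hcu
  refine ⟨ε', ?_, ?_, ?_⟩
  · intro i u hu z hz hc hi
    have hz' : extendₗ k _ z ∈ C.below i u := extendₗ_mem_supported hz
    obtain ⟨hux, hua, hua'⟩ := hadm u hu
    cases i with
    | zero =>
      obtain ⟨t, ht, hzt⟩ := hcyc hu hz' trivial
      exact hbd hu ht hzt
    | succ i =>
      -- The boundary of a lifted face cycle lies in the lower strand. Once it bounds there,
      -- subtracting `y'` turns the lift into a genuine cycle, to which `hcyc` applies.
      have hy : C.D i (extendₗ k _ z) ∈ C.below i (u.update x (e - 1)) :=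
        hup hu (D_mem_below hz') hc
      obtain ⟨y', hy', hyy⟩ := h.exact i _ hua' _ hy (D_mem_cycles i _) (by
        rintro rfl
        rcases hJ u hu with ⟨h1, h2⟩ | ⟨h1, h2, h3⟩
        · rw [← h2]
          exact hi rfl
        · exact Or.inr (h.aug_D u hua h1 _ hz'))
      obtain ⟨t, ht, hzt⟩ := hcyc hu (sub_mem hz' (below_mono (hle hu) hy'))
        (show C.D i _ = 0 by rw [map_sub, hyy, sub_self])
      refine hbd hu ht ?_
      have := add_mem hzt hy'
      rwa [sub_right_comm, sub_add_cancel] at this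
  · intro u hu huJ z hz
    obtain ⟨hux, hua, hua'⟩ := hadm u hu
    have h2 : u.update x (e - 1) ∉ J := by
      rcases hJ u hu with ⟨h1, h2⟩ | ⟨h1, h2, h3⟩
      · rwa [← h2]
      · exact absurd h3 huJ
    have h3 := h.aug_D _ hua' h2 _ (hdec hu (D_mem_below (extendₗ_mem_supported hz)))
    rw [map_sub, C.D_comp, zero_sub, map_neg, neg_eq_zero] at h3
    exact h3
  · intro u hu huJ
    obtain ⟨hux, hua, hua'⟩ := hadm u hu
    rcases hJ u hu with ⟨h1, h2⟩ | ⟨h1, h2, h3⟩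
    swap
    · exact absurd h3 huJ
    rw [h2] at huJ
    obtain ⟨c, hcu, hcc, hc1⟩ := h.surj _ hua' huJ
    -- The class `c` of the lower strand dies in the strand of `u`; the face part of a chain
    -- bounding it is the required class one degree higher.
    obtain ⟨z, hz, rfl⟩ := h.exact n u hua c (below_mono (hle hu) hcu) hcc fun _ => Or.inl h1
    have h4 := hdec hu hz
    refine ⟨restrictₗ k _ z, restrictₗ_mem_supported hz, ?_, ?_⟩
    · have h5 := hdown hu (D_mem_below h4)
      rw [map_sub, map_sub, hdown hu hcu, zero_sub, neg_eq_zero] at h5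
      exact h5
    · have h5 := h.aug_D _ hua' huJ _ h4
      rw [map_sub, map_sub, hc1, sub_eq_zero] at h5
      exact h5.symm

end Face
end FilteredComplex
end MonomialResolution

/-! ### Uniqueness of minimal filtered complexes -/

namespace MonomialResolution

universe u v w w'

namespace FilteredComplex

variable {k : Type u} [Field k] {Λ : Type v} [PartialOrder Λ]
  {C : FilteredComplex.{u, v, w} k Λ} {C' : FilteredComplex.{u, v, w'} k Λ}

/-- `f` does not increase degrees, as far as degrees at most `t` are concerned. -/
def IsFiltered (C : FilteredComplex.{u, v, w} k Λ) (C' : FilteredComplex.{u, v, w'} k Λ) (t : Λ)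
    {i j : ℕ} (f : (C.B i →₀ k) →ₗ[k] (C'.B j →₀ k)) : Prop :=
  ∀ u ≤ t, ∀ z ∈ C.below i u, f z ∈ C'.below j u

theorem IsFiltered.map_strictlyBelow {t : Λ} {i j : ℕ} {f : (C.B i →₀ k) →ₗ[k] (C'.B j →₀ k)}
    (hf : IsFiltered C C' t f) {u : Λ} (hu : u ≤ t) {z : C.B i →₀ k}
    (hz : z ∈ C.strictlyBelow i u) : f z ∈ C'.strictlyBelow j u := by
  refine map_mem_of_forall_single f (fun b hb => ?_) hz
  refine Finsupp.supported_mono ?_ (hf _ (le_trans (le_of_lt hb) hu) _ (single_mem_below le_rfl 1))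
  exact fun c hc => lt_of_le_of_lt hc hb

/-- Lifts are chosen on basis elements of degree at most `t` only; the values elsewhere are
irrelevant, so hypotheses are needed only below `t`. -/
theorem exists_filtered_lift {V : Type*} [AddCommGroup V] [Module k V] (t : Λ) {i j : ℕ}
    (ψ : (C.B i →₀ k) →ₗ[k] V) (p : (C'.B j →₀ k) →ₗ[k] V)
    (h : ∀ b, C.deg i b ≤ t → ∃ y ∈ C'.below j (C.deg i b), p y = ψ (Finsupp.single b 1)) :
    ∃ f : (C.B i →₀ k) →ₗ[k] (C'.B j →₀ k), IsFiltered C C' t f ∧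
      ∀ z ∈ C.below i t, p (f z) = ψ z := by
  choose! y hy hp using h
  refine ⟨Finsupp.linearCombination k y, ?_, ?_⟩
  · intro u hu z hz
    refine map_mem_of_forall_single _ (fun b hb => ?_) hz
    rw [Finsupp.linearCombination_single, one_smul]
    exact below_mono hb (hy b (le_trans hb hu))
  · intro z hz
    refine map_eq_of_forall_single (p ∘ₗ Finsupp.linearCombination k y) ψ (fun b hb => ?_) hz
    simp [hp b hb]

/-- One half of a filtered homotopy equivalence in homological degree `i`: the map `f` can be
continued, and `g ∘ f` is homotopic to the identity. -/
structure HalfEquivalence (C : FilteredComplex.{u, v, w} k Λ)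
    (C' : FilteredComplex.{u, v, w'} k Λ) (t : Λ) {i : ℕ}
    (f : (C.B i →₀ k) →ₗ[k] (C'.B i →₀ k)) (g : (C'.B i →₀ k) →ₗ[k] (C.B i →₀ k)) : Prop where
  filtered : IsFiltered C C' t f
  lifts : ∀ b, C.deg (i + 1) b ≤ t → ∃ y ∈ C'.below (i + 1) (C.deg (i + 1) b),
    C'.D i y = f (C.D i (Finsupp.single b 1))
  homotopy : ∃ h : (C.B i →₀ k) →ₗ[k] (C.B (i + 1) →₀ k), IsFiltered C C t h ∧
    ∀ z ∈ C.below (i + 1) t, C.D i (h (C.D i z)) = g (f (C.D i z)) - C.D i z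
  graded : ∀ b, C.deg i b ≤ t →
    g (f (Finsupp.single b 1)) - Finsupp.single b 1 ∈ C.strictlyBelow i (C.deg i b)

variable {t : Λ} {adm J : Set Λ} {ε : ∀ i, (C.B i →₀ k) →ₗ[k] k}
  {ε' : ∀ i, (C'.B i →₀ k) →ₗ[k] k}

/-- The usual comparison argument: `g' ∘ f' - id - h ∘ D` takes values in cycles and lifts to the
next homotopy. By minimality both terms of `D h' + h D` strictly lower degrees, so `g' ∘ f'` is the
identity on graded parts. Stating the homotopy only on boundaries makes the preceding homotopy
disappear, so degree 0 needs no special form. -/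
theorem HalfEquivalence.succ (hmin : C.IsMinimal) (hC : C.IsResolving 0 adm J ε)
    (hC' : C'.IsResolving 0 adm J ε')
    (hadm : ∀ i b, C.deg i b ≤ t → C.deg i b ∈ adm)
    {i : ℕ} {f : (C.B i →₀ k) →ₗ[k] (C'.B i →₀ k)} {g : (C'.B i →₀ k) →ₗ[k] (C.B i →₀ k)}
    {f' : (C.B (i + 1) →₀ k) →ₗ[k] (C'.B (i + 1) →₀ k)}
    {g' : (C'.B (i + 1) →₀ k) →ₗ[k] (C.B (i + 1) →₀ k)}
    (H : HalfEquivalence C C' t f g)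
    (hf' : IsFiltered C C' t f') (hff' : ∀ z ∈ C.below (i + 1) t, C'.D i (f' z) = f (C.D i z))
    (hg' : IsFiltered C' C t g') (hgg' : ∀ z ∈ C'.below (i + 1) t, C.D i (g' z) = g (C'.D i z)) :
    HalfEquivalence C C' t f' g' := by
  obtain ⟨h, hh, hhD⟩ := H.homotopy
  obtain ⟨h', hh', hhD'⟩ := exists_filtered_lift (C := C) (C' := C) t
    (g' ∘ₗ f' - LinearMap.id - h ∘ₗ C.D i) (C.D (i + 1)) (by
      intro b hb
      have hs : Finsupp.single b (1 : k) ∈ C.below (i + 1) (C.deg (i + 1) b) :=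
        single_mem_below le_rfl 1
      have hst := below_mono hb hs
      refine hC.exact (i + 1) _ (hadm _ _ hb) _ ?_ ?_ (by omega)
      · exact sub_mem (sub_mem (hg' _ hb _ (hf' _ hb _ hs)) hs) (hh _ hb _ (D_mem_below hs))
      · change C.D i (g' (f' _) - _ - h (C.D i _)) = 0
        rw [map_sub, map_sub, hhD _ hst, hgg' _ (hf' _ le_rfl _ hst), hff' _ hst]
        exact sub_self _)
  refine ⟨hf', ?_, ⟨h', hh', ?_⟩, ?_⟩
  · intro b hb
    have hs : Finsupp.single b (1 : k) ∈ C.below (i + 2) (C.deg (i + 2) b) :=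
      single_mem_below le_rfl 1
    refine hC'.exact (i + 1) _ (hadm _ _ hb) _ (hf' _ hb _ (D_mem_below hs)) ?_ (by omega)
    change C'.D i _ = 0
    rw [hff' _ (D_mem_below (below_mono hb hs)), C.D_comp, map_zero]
  · intro z hz
    rw [hhD' _ (D_mem_below hz)]
    simp [C.D_comp]
  · intro b hb
    have hs : Finsupp.single b (1 : k) ∈ C.below (i + 1) (C.deg (i + 1) b) :=
      single_mem_below le_rfl 1
    have h1 := hhD' _ (below_mono hb hs)
    have h2 : g' (f' (Finsupp.single b 1)) - Finsupp.single b 1 =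
        C.D (i + 1) (h' (Finsupp.single b 1)) + h (C.D i (Finsupp.single b 1)) := by
      rw [h1]
      simp
    rw [h2]
    exact add_mem (hmin.D_mem_strictlyBelow (hh' _ hb _ hs))
      (hh.map_strictlyBelow hb (hmin.D_mem_strictlyBelow hs))

/-- `J` need not be closed under multiples (`faceMultiples` is not), so `u ∈ J` with `v ∉ J` can
occur. Elements of the smaller strand are then boundaries, on which the augmentation of the larger
one vanishes. -/
theorem IsResolving.aug_eq_zero (hC : C.IsResolving 0 adm J ε) {u v : Λ} (huv : u ≤ v)
    (hu : u ∈ adm) (huJ : u ∈ J) (hv : v ∈ adm) (hvJ : v ∉ J) {z : C.B 0 →₀ k}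
    (hz : z ∈ C.below 0 u) : ε 0 z = 0 := by
  obtain ⟨y, hy, rfl⟩ := hC.exact 0 u hu z hz trivial fun _ => Or.inl huJ
  exact hC.aug_D v hv hvJ y (below_mono huv hy)

theorem exists_zero_lift (hC : C.IsResolving 0 adm J ε)
    (hC' : C'.IsResolving 0 adm J ε') (hadm : ∀ i b, C.deg i b ≤ t → C.deg i b ∈ adm) :
    ∃ f : (C.B 0 →₀ k) →ₗ[k] (C'.B 0 →₀ k), IsFiltered C C' t f ∧
      ∀ u ≤ t, u ∈ adm → u ∉ J → ∀ z ∈ C.below 0 u, ε' 0 (f z) = ε 0 z := by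
  classical
  obtain ⟨f, hf, hfε⟩ := exists_filtered_lift (C := C) (C' := C') (i := 0) (j := 0) t
    (Finsupp.linearCombination k fun b : C.B 0 =>
      if C.deg 0 b ∈ J then 0 else ε 0 (Finsupp.single b 1)) (ε' 0) (by
    intro b hb
    rw [Finsupp.linearCombination_single, one_smul]
    split_ifs with hJ
    · exact ⟨0, zero_mem _, map_zero _⟩
    · obtain ⟨z, hz, -, hz1⟩ := hC'.surj _ (hadm _ _ hb) hJ
      exact ⟨ε 0 (Finsupp.single b 1) • z, Submodule.smul_mem _ _ hz, by simp [hz1]⟩)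
  refine ⟨f, hf, fun u hu hua huJ z hz => ?_⟩
  rw [hfε z (below_mono hu hz)]
  refine map_eq_of_forall_single _ _ (fun b hb => ?_) hz
  rw [Finsupp.linearCombination_single, one_smul]
  split_ifs with hJ
  · exact (hC.aug_eq_zero hb (hadm _ _ (le_trans hb hu)) hJ hua huJ
      (single_mem_below le_rfl 1)).symm
  · rfl

theorem HalfEquivalence.zero (hmin : C.IsMinimal) (hC : C.IsResolving 0 adm J ε)
    (hC' : C'.IsResolving 0 adm J ε')
    (hadm : ∀ i b, C.deg i b ≤ t → C.deg i b ∈ adm)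
    {f : (C.B 0 →₀ k) →ₗ[k] (C'.B 0 →₀ k)} {g : (C'.B 0 →₀ k) →ₗ[k] (C.B 0 →₀ k)}
    (hf : IsFiltered C C' t f)
    (hfε : ∀ u ≤ t, u ∈ adm → u ∉ J → ∀ z ∈ C.below 0 u, ε' 0 (f z) = ε 0 z)
    (hg : IsFiltered C' C t g)
    (hgε : ∀ u ≤ t, u ∈ adm → u ∉ J → ∀ z ∈ C'.below 0 u, ε 0 (g z) = ε' 0 z) :
    HalfEquivalence C C' t f g := by
  obtain ⟨h, hh, hhD⟩ := exists_filtered_lift (C := C) (C' := C) t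
    (g ∘ₗ f - LinearMap.id) (C.D 0) (by
      intro b hb
      have hs : Finsupp.single b (1 : k) ∈ C.below 0 (C.deg 0 b) := single_mem_below le_rfl 1
      refine hC.exact 0 _ (hadm _ _ hb) _ (sub_mem (hg _ hb _ (hf _ hb _ hs)) hs) trivial ?_
      intro _
      by_cases hJ : C.deg 0 b ∈ J
      · exact Or.inl hJ
      · right
        change ε 0 (g (f _) - _) = 0
        rw [map_sub, hgε _ hb (hadm _ _ hb) hJ _ (hf _ hb _ hs), hfε _ hb (hadm _ _ hb) hJ _ hs]
        exact sub_self _)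
  refine ⟨hf, ?_, ⟨h, hh, ?_⟩, ?_⟩
  · intro b hb
    have hs : Finsupp.single b (1 : k) ∈ C.below 1 (C.deg 1 b) := single_mem_below le_rfl 1
    refine hC'.exact 0 _ (hadm _ _ hb) _ (hf _ hb _ (D_mem_below hs)) trivial ?_
    intro _
    by_cases hJ : C.deg 1 b ∈ J
    · exact Or.inl hJ
    · right
      rw [hfε _ hb (hadm _ _ hb) hJ _ (D_mem_below hs), hC.aug_D _ (hadm _ _ hb) hJ _ hs]
  · intro z hz
    rw [hhD _ (D_mem_below hz)]
    rfl
  · intro b hb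
    have hs : Finsupp.single b (1 : k) ∈ C.below 0 (C.deg 0 b) := single_mem_below le_rfl 1
    have h1 := hhD _ (below_mono hb hs)
    change C.D 0 _ = g (f _) - Finsupp.single b 1 at h1
    rw [← h1]
    exact hmin.D_mem_strictlyBelow (hh _ hb _ hs)

theorem exists_equivalence (hmin : C.IsMinimal) (hmin' : C'.IsMinimal)
    (hC : C.IsResolving 0 adm J ε) (hC' : C'.IsResolving 0 adm J ε')
    (hadm : ∀ i b, C.deg i b ≤ t → C.deg i b ∈ adm)
    (hadm' : ∀ i b, C'.deg i b ≤ t → C'.deg i b ∈ adm) (i : ℕ) :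
    ∃ (f : (C.B i →₀ k) →ₗ[k] (C'.B i →₀ k)) (g : (C'.B i →₀ k) →ₗ[k] (C.B i →₀ k)),
      HalfEquivalence C C' t f g ∧ HalfEquivalence C' C t g f := by
  induction i with
  | zero =>
    obtain ⟨f, hf, hfε⟩ := exists_zero_lift hC hC' hadm
    obtain ⟨g, hg, hgε⟩ := exists_zero_lift hC' hC hadm'
    exact ⟨f, g, .zero hmin hC hC' hadm hf hfε hg hgε, .zero hmin' hC' hC hadm' hg hgε hf hfε⟩
  | succ i ih =>
    obtain ⟨f, g, H, H'⟩ := ih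
    obtain ⟨f', hf', hff'⟩ := exists_filtered_lift (C := C) (C' := C') t (f ∘ₗ C.D i) (C'.D i)
      H.lifts
    obtain ⟨g', hg', hgg'⟩ := exists_filtered_lift (C := C') (C' := C) t (g ∘ₗ C'.D i) (C.D i)
      H'.lifts
    exact ⟨f', g', H.succ hmin hC hC' hadm hf' hff' hg' hgg',
      H'.succ hmin' hC' hC hadm' hg' hgg' hf' hff'⟩

/-- The part of degree `t` of a filtered map. -/
noncomputable def gradedPart (t : Λ) {i : ℕ} (f : (C.B i →₀ k) →ₗ[k] (C'.B i →₀ k)) :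
    ({b : C.B i // C.deg i b = t} →₀ k) →ₗ[k] ({b : C'.B i // C'.deg i b = t} →₀ k) :=
  restrictₗ k _ ∘ₗ f ∘ₗ extendₗ k _

/-- Filtered maps preserve the strictly lower part, so taking graded parts respects composition, and
`g ∘ f - id` is strictly lower. -/
theorem HalfEquivalence.gradedPart_comp {i : ℕ} {f : (C.B i →₀ k) →ₗ[k] (C'.B i →₀ k)}
    {g : (C'.B i →₀ k) →ₗ[k] (C.B i →₀ k)} (H : HalfEquivalence C C' t f g)
    (hg : IsFiltered C' C t g) : gradedPart t g ∘ₗ gradedPart t f = LinearMap.id := by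
  ext ⟨b, rfl⟩ : 2
  have hs : Finsupp.single b (1 : k) ∈ C.below i (C.deg i b) := single_mem_below le_rfl 1
  set y := f (Finsupp.single b 1) with hy
  have hyb : y ∈ C'.below i (C.deg i b) := H.filtered _ le_rfl _ hs
  have h1 : y - extendₗ k _ (restrictₗ k (fun c => C'.deg i c = C.deg i b) y) ∈
      C'.strictlyBelow i (C.deg i b) := by
    refine Finsupp.supported_mono ?_ (mem_supported_of_restrictₗ_eq_zero
      (p := fun c => C'.deg i c = C.deg i b) (sub_mem hyb
      (extendₗ_mem_supported (restrictₗ_mem_supported hyb))) (by simp))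
    rintro c ⟨hc, hc'⟩
    exact lt_of_le_of_ne hc hc'
  have hlt : ∀ c ∈ {c | C.deg i c < C.deg i b}, ¬ C.deg i c = C.deg i b := fun c hc => ne_of_lt hc
  have h2 := restrictₗ_eq_zero (p := fun c => C.deg i c = C.deg i b) hlt
    (hg.map_strictlyBelow le_rfl h1)
  have h3 := restrictₗ_eq_zero (p := fun c => C.deg i c = C.deg i b) hlt (H.graded b le_rfl)
  rw [map_sub, map_sub, sub_eq_zero] at h2
  rw [map_sub, sub_eq_zero] at h3
  simp only [gradedPart, LinearMap.comp_apply, Finsupp.lsingle_apply, extendₗ_single,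
    LinearMap.id_apply]
  rw [← hy, ← h2, h3]
  conv_lhs => rw [← extendₗ_single (p := fun c => C.deg i c = C.deg i b) ⟨b, rfl⟩ (1 : k)]
  rw [restrictₗ_extendₗ]

/-- Two minimal complexes with the same homology have the same numbers of basis elements. -/
theorem nonempty_equiv_of_isResolving (hmin : C.IsMinimal) (hmin' : C'.IsMinimal)
    (hC : C.IsResolving 0 adm J ε) (hC' : C'.IsResolving 0 adm J ε')
    (hadm : ∀ i b, C.deg i b ≤ t → C.deg i b ∈ adm)
    (hadm' : ∀ i b, C'.deg i b ≤ t → C'.deg i b ∈ adm) (i : ℕ) :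
    Nonempty ({b : C.B i // C.deg i b = t} ≃ {b : C'.B i // C'.deg i b = t}) := by
  obtain ⟨f, g, H, H'⟩ := exists_equivalence hmin hmin' hC hC' hadm hadm' i
  let e : ({b : C.B i // C.deg i b = t} →₀ k) ≃ₗ[k] ({b : C'.B i // C'.deg i b = t} →₀ k) :=
    LinearEquiv.ofLinearMap (gradedPart t f) (gradedPart t g) (H'.gradedPart_comp H.filtered)
      (H.gradedPart_comp H'.filtered)
  exact ⟨Module.Basis.indexEquiv (Module.Basis.ofRepr (.refl k _)) (Module.Basis.ofRepr e)⟩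

end FilteredComplex
end MonomialResolution

/-! ### Dehomogenization of multigraded resolutions -/

namespace MonomialResolution

open MvPolynomial

universe u v w

/-- The exponents of the monomials divisible by an element of `A`. -/
def multiples {σ : Type v} (A : Set (σ →₀ ℕ)) : Set (σ →₀ ℕ) := {u | ∃ a ∈ A, a ≤ u}

theorem mem_monomialIdeal_iff {k : Type u} [Field k] {σ : Type v} {A : Set (σ →₀ ℕ)}
    {p : MvPolynomial σ k} :
    p ∈ monomialIdeal k A ↔ ∀ v, v ∉ multiples A → coeff v p = 0 := by
  rw [monomialIdeal, mem_ideal_span_monomial_image]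
  refine forall_congr' fun v => ?_
  rw [mem_support_iff]
  exact not_imp_comm

theorem monomial_mem_monomialIdeal_iff {k : Type u} [Field k] {σ : Type v} {A : Set (σ →₀ ℕ)}
    {u : σ →₀ ℕ} : monomial u (1 : k) ∈ monomialIdeal k A ↔ u ∈ multiples A := by
  classical
  rw [mem_monomialIdeal_iff]
  constructor
  · intro h
    by_contra hu
    simpa using h u hu
  · intro hu v hv
    rw [coeff_monomial, if_neg]
    rintro rfl
    exact hv hu

namespace MultigradedFreeSeq

variable {k : Type u} [Field k] {σ : Type v} {M : Ideal (MvPolynomial σ k)}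
  (F : MultigradedFreeSeq.{u, v, w} M)

open Classical in
/-- The component of multidegree `u` of an element of `F_i`, as a combination of basis elements. -/
noncomputable def component (i : ℕ) (u : σ →₀ ℕ) :
    (F.basis i →₀ MvPolynomial σ k) →ₗ[k] (F.basis i →₀ k) where
  toFun y := Finsupp.onFinset y.support
    (fun c => if F.mdeg i c ≤ u then coeff (u - F.mdeg i c) (y c) else 0) (by
      intro c hc
      rw [Finsupp.mem_support_iff]
      intro h
      simp [h] at hc)
  map_add' y z := by
    ext c
    simp only [Finsupp.onFinset_apply, Finsupp.add_apply, coeff_add]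
    split_ifs <;> simp
  map_smul' a y := by
    ext c
    simp

/-- The homogeneous element of `F_i` of multidegree `u` given by a combination of basis elements. -/
noncomputable def homogenize (i : ℕ) (u : σ →₀ ℕ) (z : F.basis i →₀ k) :
    F.basis i →₀ MvPolynomial σ k :=
  Finsupp.onFinset z.support (fun b => monomial (u - F.mdeg i b) (z b)) (by
    intro b hb
    rw [Finsupp.mem_support_iff]
    intro h
    simp [h] at hb)

open Classical in
theorem component_apply {i : ℕ} {u : σ →₀ ℕ} (y : F.basis i →₀ MvPolynomial σ k) (c : F.basis i) :
    F.component i u y c = if F.mdeg i c ≤ u then coeff (u - F.mdeg i c) (y c) else 0 := rfl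

theorem homogenize_apply {i : ℕ} {u : σ →₀ ℕ} (z : F.basis i →₀ k) (c : F.basis i) :
    F.homogenize i u z c = monomial (u - F.mdeg i c) (z c) := rfl

theorem component_mem_supported {i : ℕ} {u : σ →₀ ℕ} (y : F.basis i →₀ MvPolynomial σ k) :
    F.component i u y ∈ Finsupp.supported k k {b | F.mdeg i b ≤ u} := by
  rw [Finsupp.mem_supported']
  intro c hc
  exact if_neg hc

theorem component_homogenize {i : ℕ} {u : σ →₀ ℕ} {z : F.basis i →₀ k}
    (hz : z ∈ Finsupp.supported k k {b | F.mdeg i b ≤ u}) :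
    F.component i u (F.homogenize i u z) = z := by
  classical
  ext c
  rw [component_apply, homogenize_apply]
  split_ifs with h
  · simp
  · exact ((Finsupp.mem_supported' k z).1 hz c h).symm

theorem component_homogenize_of_ne {i : ℕ} {u v : σ →₀ ℕ} (huv : v ≠ u) {z : F.basis i →₀ k}
    (hz : z ∈ Finsupp.supported k k {b | F.mdeg i b ≤ u}) :
    F.component i v (F.homogenize i u z) = 0 := by
  classical
  ext c
  rw [component_apply, homogenize_apply, Finsupp.zero_apply]
  split_ifs with h
  · by_cases h' : F.mdeg i c ≤ u
    · rw [coeff_monomial, if_neg]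
      intro e
      exact huv (by rw [← tsub_add_cancel_of_le h, ← e, tsub_add_cancel_of_le h'])
    · simp [(Finsupp.mem_supported' k z).1 hz c h']
  · rfl

theorem eq_zero_of_component {i : ℕ} {y : F.basis i →₀ MvPolynomial σ k}
    (h : ∀ v, F.component i v y = 0) : y = 0 := by
  ext c e
  have := DFunLike.congr_fun (h (e + F.mdeg i c)) c
  rw [component_apply, if_pos le_add_self, add_tsub_cancel_right] at this
  simpa using this

open Classical in
theorem component_single_monomial {i : ℕ} {u e : σ →₀ ℕ} (b : F.basis i) (a : k) :
    F.component i u (Finsupp.single b (monomial e a)) =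
      if e + F.mdeg i b = u then Finsupp.single b a else 0 := by
  ext c
  rw [component_apply]
  by_cases hc : b = c
  · subst hc
    rw [Finsupp.single_eq_same, coeff_monomial]
    by_cases h : e + F.mdeg i b = u
    · subst h
      simp
    · rw [if_neg h]
      split_ifs with h1 h2
      · exact absurd (by rw [h2, tsub_add_cancel_of_le h1]) h
      · rfl
      · rfl
  · have : (if e + F.mdeg i b = u then Finsupp.single b a else 0 : F.basis i →₀ k) c = 0 := by
      split_ifs
      · exact Finsupp.single_eq_of_ne' hc
      · rfl
    rw [this, Finsupp.single_eq_of_ne' hc]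
    simp

/-- The differential of the dehomogenization. -/
noncomputable def dehomD (i : ℕ) : (F.basis (i + 1) →₀ k) →ₗ[k] (F.basis i →₀ k) :=
  Finsupp.linearCombination k fun b =>
    F.component i (F.mdeg (i + 1) b) (F.d i (Finsupp.single b 1))

theorem induction_monomial {α : Type*} {p : (α →₀ MvPolynomial σ k) → Prop}
    (h0 : p 0) (hadd : ∀ y z, p y → p z → p (y + z))
    (h : ∀ b e a, p (Finsupp.single b (monomial e a))) (y : α →₀ MvPolynomial σ k) : p y := by
  induction y using Finsupp.induction_linear with
  | zero => exact h0
  | add y z hy hz => exact hadd y z hy hz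
  | single b q =>
    induction q using MvPolynomial.induction_on' with
    | monomial e a => exact h b e a
    | add q r hq hr =>
      rw [Finsupp.single_add]
      exact hadd _ _ hq hr

/-- By homogeneity each matrix entry is a scalar times one monomial, so the differential on the
strand of multidegree `u` has the same scalar matrix for every `u`. -/
theorem component_d {i : ℕ} (u : σ →₀ ℕ) (y : F.basis (i + 1) →₀ MvPolynomial σ k) :
    F.component i u (F.d i y) = F.dehomD i (F.component (i + 1) u y) := by
  classical
  induction y using induction_monomial with
  | h0 => simp
  | hadd y z hy hz => rw [map_add, map_add, map_add, map_add, hy, hz]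
  | h b e a =>
    have h1 : Finsupp.single b (monomial e a) =
        monomial e a • Finsupp.single b (1 : MvPolynomial σ k) := by
      rw [Finsupp.smul_single, smul_eq_mul, mul_one]
    rw [component_single_monomial, h1, map_smul]
    ext c
    rw [component_apply, Finsupp.smul_apply, smul_eq_mul]
    have hp := F.d_homogeneous i b c
    set p := F.d i (Finsupp.single b 1) c with hpdef
    have hR : (F.dehomD i (if e + F.mdeg (i + 1) b = u then Finsupp.single b a else 0)) c =
        if e + F.mdeg (i + 1) b = u then
          (if F.mdeg i c ≤ F.mdeg (i + 1) b then
            a * coeff (F.mdeg (i + 1) b - F.mdeg i c) p else 0) else 0 := by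
      split_ifs with h1 h2
      · rw [dehomD, Finsupp.linearCombination_single, Finsupp.smul_apply, component_apply,
          if_pos h2, smul_eq_mul]
      · rw [dehomD, Finsupp.linearCombination_single, Finsupp.smul_apply, component_apply,
          if_neg h2, smul_zero]
      · simp
    rw [hR]
    by_cases hp0 : p = 0
    · simp [hp0]
    · obtain ⟨f, hf⟩ := support_nonempty.2 hp0
      have hfb := hp f hf
      have hpm : p = monomial f (coeff f p) := by
        ext g
        rw [coeff_monomial]
        split_ifs with hfg
        · rw [hfg]
        · by_contra hg
          exact hfg (add_right_cancel (hfb.trans (hp g (mem_support_iff.2 hg)).symm))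
      rw [hpm, monomial_mul, coeff_monomial, coeff_monomial, ← hfb, add_tsub_cancel_right,
        if_pos le_add_self, if_pos rfl, ← add_assoc]
      by_cases h : e + f + F.mdeg i c = u
      · subst h
        simp
      · rw [if_neg h]
        split_ifs with h1 h2
        · exact absurd (by rw [h2, tsub_add_cancel_of_le h1]) h
        · rfl
        · rfl

variable {F}

theorem IsResolution.d_comp (hF : F.IsResolution) (i : ℕ)
    (y : F.basis (i + 2) →₀ MvPolynomial σ k) : F.d i (F.d (i + 1) y) = 0 :=
  (hF.2.2 i).apply_apply_eq_zero y

/-- The complex of vector spaces obtained from a resolution by setting all variables to `1`. -/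
noncomputable def IsResolution.dehomogenize (hF : F.IsResolution) :
    FilteredComplex.{u, v, w} k (σ →₀ ℕ) where
  B := F.basis
  deg := F.mdeg
  D := F.dehomD
  D_le i b := by
    rw [dehomD, Finsupp.linearCombination_single, one_smul]
    exact F.component_mem_supported _
  D_comp i z := by
    classical
    refine (Submodule.mem_bot k).1 (map_mem_of_forall_single (s := Set.univ) (N := ⊥)
      (F.dehomD i ∘ₗ F.dehomD (i + 1)) (fun b _ => ?_) (by simp))
    have h := F.component_single_monomial (u := F.mdeg (i + 2) b) (e := 0) b 1
    rw [if_pos (zero_add _)] at h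
    rw [Submodule.mem_bot, LinearMap.comp_apply, ← h, ← component_d, ← component_d, hF.d_comp,
      map_zero]

theorem IsMinimalResolution.isMinimal (hF : F.IsMinimalResolution) :
    hF.1.dehomogenize.IsMinimal := by
  intro i (b : F.basis (i + 1)) (c : F.basis i) hbc
  have h1 := F.d_homogeneous i b c
  have h2 := hF.2 i b c
  change ¬ IsUnit (F.d i (Finsupp.single b 1) c) at h2
  change F.dehomD i (Finsupp.single b 1) c = 0
  change F.mdeg i c = F.mdeg (i + 1) b at hbc
  rw [dehomD, Finsupp.linearCombination_single, one_smul, component_apply, if_pos hbc.le, hbc,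
    tsub_self]
  set p := F.d i (Finsupp.single b 1) c
  by_contra h0
  classical
  have hp : p = C (coeff 0 p) := by
    ext g
    rw [coeff_C]
    split_ifs with hg
    · rw [← hg]
    · by_contra hg'
      have := h1 g (mem_support_iff.2 hg')
      rw [hbc] at this
      exact hg (by simpa using this.symm : g = 0).symm
  refine h2 ?_
  rw [hp]
  exact (IsUnit.mk0 _ h0).map C

/-- Exactness is read off in each multidegree: the component of S/M in multidegree `u` is `k` or 0
according to whether the monomial lies outside M. The augmentation records the scalars by which
basis elements of `F_0` map to S/M. -/
theorem IsResolution.isResolving {A : Set (σ →₀ ℕ)}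
    {F : MultigradedFreeSeq.{u, v, w} (monomialIdeal k A)} (hF : F.IsResolution) :
    ∃ ε, hF.dehomogenize.IsResolving 0 Set.univ (multiples A) ε := by
  classical
  choose a ha using F.aug_homogeneous
  let p : (F.basis 0 →₀ MvPolynomial σ k) →ₗ[MvPolynomial σ k] MvPolynomial σ k :=
    Finsupp.linearCombination _ fun b => monomial (F.mdeg 0 b) (a b)
  have hp : ∀ y, F.aug y = Ideal.Quotient.mk _ (p y) := by
    have : F.aug =
        (Ideal.Quotient.mkₐ (MvPolynomial σ k) (monomialIdeal k A)).toLinearMap ∘ₗ p := by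
      ext b
      simp [p, ha]
    intro y
    rw [this]
    rfl
  let ε₀ : (F.basis 0 →₀ k) →ₗ[k] k := Finsupp.linearCombination k a
  have hε : ∀ v y, coeff v (p y) = ε₀ (F.component 0 v y) := by
    intro v y
    induction y using induction_monomial with
    | h0 => simp
    | hadd y z hy hz => rw [map_add, map_add, map_add, coeff_add, hy, hz]
    | h b e x =>
      rw [component_single_monomial]
      simp only [p, ε₀, Finsupp.linearCombination_single, smul_eq_mul, monomial_mul, coeff_monomial]
      split_ifs with h
      · simp
      · simp
  have haug : ∀ y, F.aug y = 0 ↔ ∀ v, v ∉ multiples A → ε₀ (F.component 0 v y) = 0 := by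
    intro y
    rw [hp, Ideal.Quotient.eq_zero_iff_mem, mem_monomialIdeal_iff]
    simp only [hε]
  refine ⟨fun i => match i with
    | 0 => ε₀
    | i + 1 => 0, ?_, ?_, ?_⟩
  · intro i u _ z hz hc hi
    have hlift : ∀ y, F.d i y = F.homogenize i u z →
        ∃ y ∈ hF.dehomogenize.below (i + 1) u, hF.dehomogenize.D i y = z := by
      intro y hy
      refine ⟨F.component (i + 1) u y, F.component_mem_supported y, ?_⟩
      change F.dehomD i _ = z
      rw [← component_d, hy, F.component_homogenize hz]
    cases i with
    | zero =>
      obtain ⟨y, hy⟩ := (hF.2.1 (F.homogenize 0 u z)).1 (by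
        rw [haug]
        intro v hv
        by_cases huv : v = u
        · subst huv
          rw [F.component_homogenize hz]
          exact (hi rfl).resolve_left hv
        · rw [F.component_homogenize_of_ne huv hz, map_zero])
      exact hlift y hy
    | succ i =>
      obtain ⟨y, hy⟩ := (hF.2.2 i (F.homogenize (i + 1) u z)).1 (by
        refine F.eq_zero_of_component fun v => ?_
        rw [component_d]
        by_cases huv : v = u
        · subst huv
          rw [F.component_homogenize hz]
          exact hc
        · rw [F.component_homogenize_of_ne huv hz, map_zero])
      exact hlift y hy
  · intro u _ hu z hz
    have h := (haug (F.d 0 (F.homogenize 1 u z))).1 (hF.2.1.apply_apply_eq_zero _) u hu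
    rwa [component_d, F.component_homogenize hz] at h
  · intro u _ hu
    obtain ⟨y, hy⟩ := hF.1 (Ideal.Quotient.mk _ 1)
    -- The multidegree-0 part of a preimage of 1 serves every `u`, since all strands contain that of
    -- 0.
    refine ⟨F.component 0 0 y, FilteredComplex.below_mono (C := hF.dehomogenize) (bot_le : 0 ≤ u)
      (F.component_mem_supported y), trivial, ?_⟩
    rw [hp, Ideal.Quotient.mk_eq_mk_iff_sub_mem, mem_monomialIdeal_iff] at hy
    have h := hy 0 (by
      rintro ⟨g, hg, hg0⟩
      exact hu ⟨g, hg, hg0.trans bot_le⟩)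
    rw [coeff_sub, hε, coeff_zero_one, sub_eq_zero] at h
    exact h

end MultigradedFreeSeq
end MonomialResolution

/-! ### Translation by a monomial and iterated dominant faces -/

namespace MonomialResolution

universe u v w

namespace FilteredComplex

variable {k : Type u} [Field k] {σ : Type v}

/-- The complex `C` with all degrees multiplied by the monomial `m`. -/
noncomputable def translate (C : FilteredComplex.{u, v, w} k (σ →₀ ℕ)) (m : σ →₀ ℕ) :
    FilteredComplex.{u, v, w} k (σ →₀ ℕ) where
  B := C.B
  deg i b := C.deg i b + m
  D := C.D
  D_le i b := by simpa using C.D_le i b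
  D_comp := C.D_comp

theorem IsMinimal.translate {C : FilteredComplex.{u, v, w} k (σ →₀ ℕ)} (h : C.IsMinimal)
    (m : σ →₀ ℕ) : (C.translate m).IsMinimal :=
  fun i b c hbc => h i b c (add_right_cancel hbc)

theorem translate_below (C : FilteredComplex.{u, v, w} k (σ →₀ ℕ)) {m u : σ →₀ ℕ} (h : m ≤ u)
    (i : ℕ) : (C.translate m).below i u = C.below i (u - m) :=
  congrArg (Finsupp.supported k k) (Set.ext fun _ => (le_tsub_iff_right h).symm)

theorem eq_zero_of_mem_translate_below {C : FilteredComplex.{u, v, w} k (σ →₀ ℕ)}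
    {m u : σ →₀ ℕ} (h : ¬ m ≤ u) {i : ℕ} {z : C.B i →₀ k}
    (hz : z ∈ (C.translate m).below i u) : z = 0 := by
  ext b
  exact (Finsupp.mem_supported' k z).1 hz b fun hb => h (le_trans le_add_self hb)

theorem IsResolving.translate {C : FilteredComplex.{u, v, w} k (σ →₀ ℕ)} {J : Set (σ →₀ ℕ)}
    {ε : ∀ i, (C.B i →₀ k) →ₗ[k] k} (h : C.IsResolving 0 Set.univ J ε) (m : σ →₀ ℕ) :
    (C.translate m).IsResolving 0 Set.univ {u | ¬ m ≤ u ∨ u - m ∈ J} ε where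
  exact i u _ z hz hc hi := by
    by_cases hu : m ≤ u
    · rw [translate_below C hu] at hz ⊢
      refine h.exact i (u - m) trivial z hz ?_ fun e => (hi e).imp_left fun h' => ?_
      · cases i with
        | zero => trivial
        | succ i => exact hc
      · exact h'.resolve_left fun h'' => h'' hu
    · exact ⟨0, zero_mem _, (map_zero _).trans (eq_zero_of_mem_translate_below hu hz).symm⟩
  aug_D u _ huJ z hz := by
    obtain ⟨h1, h2⟩ := not_or.1 huJ
    rw [translate_below C (not_not.1 h1)] at hz
    exact h.aug_D _ trivial h2 z hz
  surj u _ huJ := by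
    obtain ⟨h1, h2⟩ := not_or.1 huJ
    rw [translate_below C (not_not.1 h1)]
    exact h.surj _ trivial h2

/-- The multidegrees whose exponent at a chosen variable of each `r ∈ R` is that of `r`. -/
def dominantFace {D : Set (σ →₀ ℕ)} (x : ∀ r ∈ D, σ) (R : Finset (σ →₀ ℕ)) : Set (σ →₀ ℕ) :=
  {u | ∀ r ∈ R, ∀ h : r ∈ D, u (x r h) = r (x r h)}

/-- The multidegrees divisible by an element of `G \ R`, or not divisible by one of `R`. -/
def faceMultiples (G : Set (σ →₀ ℕ)) (R : Finset (σ →₀ ℕ)) : Set (σ →₀ ℕ) :=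
  {u | (∃ g ∈ G, g ∉ R ∧ g ≤ u) ∨ ∃ r ∈ R, ¬ r ≤ u}

/-- Restricting a resolution to the multidegrees which agree with the dominant elements `R` at
their dominant variables raises the homological degree of the homology by the size of `R`. -/
theorem exists_dominantFace {C : FilteredComplex.{u, v, w} k (σ →₀ ℕ)} {G D : Set (σ →₀ ℕ)}
    {ε : ∀ i, (C.B i →₀ k) →ₗ[k] k} (hmin : C.IsMinimal)
    (hC : C.IsResolving 0 Set.univ (multiples G) ε) (hDG : D ⊆ G) (x : ∀ r ∈ D, σ)
    (hx : ∀ r h, 0 < r (x r h) ∧ ∀ b ∈ G, b ≠ r → b (x r h) < r (x r h))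
    (R : Finset (σ →₀ ℕ)) (hR : ↑R ⊆ D) :
    ∃ (C' : FilteredComplex.{u, v, w} k (σ →₀ ℕ)) (ε' : _), C'.IsMinimal ∧
      C'.IsResolving R.card (dominantFace x R) (faceMultiples G R) ε' ∧
      (∀ i b, C'.deg i b ∈ dominantFace x R) ∧
      ∀ i, ∀ l ∈ dominantFace x R,
        Nonempty ({b : C'.B i // C'.deg i b = l} ≃ {b : C.B i // C.deg i b = l}) := by
  classical
  induction R using Finset.induction_on with
  | empty =>
    refine ⟨C, ε, hmin, ?_, by simp [dominantFace], fun _ _ _ => ⟨Equiv.refl _⟩⟩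
    exact hC.congr (Set.subset_univ _) (by simp [faceMultiples, multiples])
  | insert r A hrA ih =>
    rw [Finset.coe_insert, Set.insert_subset_iff] at hR
    obtain ⟨hrD, hAD⟩ := hR
    obtain ⟨C', ε', hmin', hC', hdeg, heq⟩ := ih hAD
    obtain ⟨hpos, hlt⟩ := hx r hrD
    set y := x r hrD with hy
    set e := r y with he
    have hface : ∀ u, u ∈ dominantFace x (insert r A) ↔ u y = e ∧ u ∈ dominantFace x A := by
      intro u
      simp only [dominantFace, Set.mem_ofPred_eq, Finset.forall_mem_insert]
      exact and_congr_left fun _ => ⟨fun h => h hrD, fun h _ => h⟩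
    have hAy : ∀ s ∈ A, s ∈ G ∧ s ≠ r ∧ s y ≠ e := by
      intro s hs
      have h1 : s ≠ r := fun h => hrA (h ▸ hs)
      exact ⟨hDG (hAD hs), h1, (hlt s (hDG (hAD hs)) h1).ne⟩
    have hGy : ∀ {u : σ →₀ ℕ}, u y = e → ∀ g ∈ G, g ≠ r → (g ≤ u.update y (e - 1) ↔ g ≤ u) := by
      intro u hu g hg hgr
      rw [le_update_iff hpos hu]
      exact and_iff_left (hlt g hg hgr).ne
    have hGr : ∀ {u : σ →₀ ℕ}, u y = e → ¬ r ≤ u.update y (e - 1) := by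
      intro u hu h
      exact ((le_update_iff hpos hu).1 h).2 rfl
    obtain ⟨ε'', hC''⟩ := hC'.face (x := y) (e := e) (adm' := dominantFace x (insert r A))
      (J' := faceMultiples G (insert r A)) hpos (by
        intro u hu
        obtain ⟨h1, h2⟩ := (hface u).1 hu
        refine ⟨h1, h2, fun s hs hsD => ?_⟩
        -- Two distinct generators cannot both have the strictly largest exponent at one variable,
        -- so lowering at `y` stays in the earlier faces.
        have hne : x s hsD ≠ y := by
          intro h
          have h3 := (hx s hsD).2 r (hDG hrD) (hAy s hs).2.1.symm
          have h4 := hlt s (hAy s hs).1 (hAy s hs).2.1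
          rw [h] at h3
          exact lt_asymm h3 h4
        rw [Finsupp.coe_update, Function.update_of_ne hne]
        exact h2 s hs hsD) (by
        intro u hu
        obtain ⟨h1, h2⟩ := (hface u).1 hu
        -- If `r` divides `u`, the strand of `u` is acyclic because `r` is still among the
        -- generators outside `A`, and the class comes from the lowered strand. Otherwise lowering
        -- changes no divisibility, and the two strands cancel.
        by_cases hru : r ≤ u
        · left
          refine ⟨Or.inl ⟨r, hDG hrD, hrA, hru⟩, ?_⟩
          refine or_congr ⟨?_, ?_⟩ ⟨?_, ?_⟩
          · rintro ⟨g, hg, hgA, hgu⟩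
            rw [Finset.mem_insert, not_or] at hgA
            exact ⟨g, hg, hgA.2, (hGy h1 g hg hgA.1).2 hgu⟩
          · rintro ⟨g, hg, hgA, hgu⟩
            have hgr : g ≠ r := by
              rintro rfl
              exact hGr h1 hgu
            exact ⟨g, hg, by simp [hgr, hgA], (hGy h1 g hg hgr).1 hgu⟩
          · rintro ⟨s, hs, hsu⟩
            have hsr : s ≠ r := by
              rintro rfl
              exact hsu hru
            have hsA := Finset.mem_of_mem_insert_of_ne hs hsr
            exact ⟨s, hsA, fun h => hsu ((hGy h1 s (hAy s hsA).1 hsr).1 h)⟩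
          · rintro ⟨s, hs, hsu⟩
            exact ⟨s, Finset.mem_insert_of_mem hs,
              fun h => hsu ((hGy h1 s (hAy s hs).1 (hAy s hs).2.1).2 h)⟩
        · have hiff : u ∈ faceMultiples G A ↔ u.update y (e - 1) ∈ faceMultiples G A := by
            refine or_congr ⟨?_, ?_⟩ ⟨?_, ?_⟩
            · rintro ⟨g, hg, hgA, hgu⟩
              have hgr : g ≠ r := by
                rintro rfl
                exact hru hgu
              exact ⟨g, hg, hgA, (hGy h1 g hg hgr).2 hgu⟩
            · rintro ⟨g, hg, hgA, hgu⟩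
              exact ⟨g, hg, hgA, ((le_update_iff hpos h1).1 hgu).1⟩
            · rintro ⟨s, hs, hsu⟩
              exact ⟨s, hs, fun h => hsu ((le_update_iff hpos h1).1 h).1⟩
            · rintro ⟨s, hs, hsu⟩
              exact ⟨s, hs, fun h => hsu ((hGy h1 s (hAy s hs).1 (hAy s hs).2.1).2 h)⟩
          have hJ' : u ∈ faceMultiples G (insert r A) :=
            Or.inr ⟨r, Finset.mem_insert_self _ _, hru⟩
          by_cases hu' : u ∈ faceMultiples G A
          · exact Or.inl ⟨hu', iff_of_true hJ' (hiff.1 hu')⟩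
          · exact Or.inr ⟨hu', fun h => hu' (hiff.2 h), hJ'⟩)
    rw [Finset.card_insert_of_notMem hrA]
    refine ⟨C'.face y e, ε'', hmin'.restrict _ _, hC'', ?_, ?_⟩
    · intro i b
      exact (hface _).2 ⟨b.2, hdeg i b.1⟩
    · intro i l hl
      obtain ⟨h1, h2⟩ := (hface l).1 hl
      obtain ⟨E⟩ := heq i l h2
      refine ⟨Equiv.trans (Equiv.subtypeSubtypeEquivSubtype
        (p := fun b => C'.deg i b ∈ {v : σ →₀ ℕ | v y = e}) (q := fun b => C'.deg i b = l) ?_) E⟩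
      rintro b rfl
      exact h1

end FilteredComplex

/-- A minimal generator `a` is divisible by some `c` in `A`, itself divisible by some `b` in `L`. If
`b ≠ a` then `a` is redundant; otherwise `a = c`. -/
theorem IsMinGenSet.subset {k : Type u} [Field k] {σ : Type v} {L A : Set (σ →₀ ℕ)}
    (h : IsMinGenSet k L (monomialIdeal k A)) : L ⊆ A := by
  intro a ha
  have key : ∀ u, u ∈ multiples L ↔ u ∈ multiples A := fun u => by
    rw [← monomial_mem_monomialIdeal_iff (k := k), ← monomial_mem_monomialIdeal_iff (k := k), h.1]
  obtain ⟨c, hc, hca⟩ := (key a).1 ⟨a, ha, le_rfl⟩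
  obtain ⟨b, hb, hbc⟩ := (key c).2 ⟨c, hc, le_rfl⟩
  by_cases hba : b = a
  · rwa [← le_antisymm hca (hba ▸ hbc)]
  · refine absurd ?_ (h.2 (L \ {a}) (Set.sdiff_singleton_ssubset.2 ha))
    ext p
    rw [← h.1, mem_monomialIdeal_iff, mem_monomialIdeal_iff]
    refine forall_congr' fun v => ?_
    have : v ∈ multiples (L \ {a}) ↔ v ∈ multiples L := by
      constructor
      · rintro ⟨d, hd, hdv⟩
        exact ⟨d, hd.1, hdv⟩
      · rintro ⟨d, hd, hdv⟩
        by_cases hda : d = a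
        · exact ⟨b, ⟨hb, hba⟩, hbc.trans (hca.trans (hda ▸ hdv))⟩
        · exact ⟨d, ⟨hd, hda⟩, hdv⟩
    rw [this]

/-- Faces need a positive exponent to lower. It is automatic unless `a` is the only generator; then
any variable of `a` works, and `a ≠ 0` because the ideal is proper. -/
theorem IsDominantIn.exists_pos {k : Type u} [Field k] {σ : Type v} {G : Set (σ →₀ ℕ)}
    (hG : monomialIdeal k G ≠ ⊤) {a : σ →₀ ℕ} (ha : IsDominantIn G a) :
    ∃ x, 0 < a x ∧ ∀ b ∈ G, b ≠ a → b x < a x := by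
  obtain ⟨haG, x, hx⟩ := ha
  by_cases h : ∃ b ∈ G, b ≠ a
  · obtain ⟨b, hb, hba⟩ := h
    exact ⟨x, (Nat.zero_le _).trans_lt (hx b hb hba), hx⟩
  · have ha0 : a ≠ 0 := by
      rintro rfl
      exact hG ((Ideal.eq_top_iff_one _).2
        (monomial_mem_monomialIdeal_iff.2 ⟨0, haG, le_rfl⟩))
    obtain ⟨y, hy⟩ := Finsupp.ne_iff.1 ha0
    exact ⟨y, Nat.pos_of_ne_zero hy, fun b hb hba => absurd ⟨b, hb, hba⟩ h⟩

end MonomialResolution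

/-! ### Comparison of the two resolutions up to mm' -/

open MonomialResolution in
theorem theorem11 {k : Type*} [Field k] {σ : Type*} [Finite σ]
    -- a proper monomial ideal `M` with minimal generating set `G`
    (M : Ideal (MvPolynomial σ k)) (hM : M ≠ ⊤)
    (G : Set (σ →₀ ℕ)) (hG : IsMinGenSet k G M)
    -- `D = {m_1, …, m_d}` consists of dominant elements of `G`, and `G \ D = {h_1, …, h_c}`
    (D : Set (σ →₀ ℕ)) (hD : ∀ a ∈ D, IsDominantIn G a)
    -- `R = {m_{r_1}, …, m_{r_j}} ⊆ D`, and `m` is the least common multiple of its elements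
    (R : Finset (σ →₀ ℕ)) (hR : (R : Set (σ →₀ ℕ)) ⊆ D)
    (j : ℕ) (hj : R.card = j) (m : σ →₀ ℕ) (hm : m = R.sup id)
    -- `l_1, …, l_q` are the distinct minimal generators of `M_m`,
    -- and `m'` occurs in the Taylor resolution that they determine
    {q : ℕ} (l : Fin q → (σ →₀ ℕ)) (hl : Function.Injective l)
    (hlM : IsMinGenSet k (Set.range l) (lcmQuotientIdeal k m (G \ D)))
    (m' : σ →₀ ℕ) (hm' : (taylor k l).Occurs m')
    -- minimal resolutions `𝔽` of `S/M_m` and `𝔾` of `S/M`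
    (𝔽 : MultigradedFreeSeq (lcmQuotientIdeal k m (G \ D))) (h𝔽 : 𝔽.IsMinimalResolution)
    (𝔾 : MultigradedFreeSeq M) (h𝔾 : 𝔾.IsMinimalResolution) :
    (∀ i < j, IsEmpty (𝔾.basisOfDegree i (m + m'))) ∧
      ∀ i : ℕ, Nonempty (𝔽.basisOfDegree i m' ≃ 𝔾.basisOfDegree (i + j) (m + m')) := by
  obtain ⟨rfl, -⟩ := hG
  have hDG : D ⊆ G := fun a ha => (hD a ha).1
  choose x hx using fun a (ha : a ∈ D) => (hD a ha).exists_pos hM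
  have hrm : ∀ r ∈ R, r ≤ m := fun r hr => hm ▸ Finset.le_sup (f := id) hr
  -- an exponent bounded on `R` and on `G \ D` is bounded on `m * m'`
  have hbound : ∀ (y : σ) (N : ℕ), (∀ r ∈ R, r y ≤ N) → (∀ h ∈ G \ D, h y ≤ N) →
      (m + m') y ≤ N := by
    intro y N h1 h2
    have hmy : m y ≤ N := by
      rw [hm]
      exact Finset.sup_induction (p := fun v : σ →₀ ℕ => v y ≤ N) (Nat.zero_le _)
        (fun a ha b hb => by simp [ha, hb]) h1
    obtain ⟨s, ⟨U, rfl⟩⟩ := hm'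
    refine Finset.sup_induction (p := fun v : σ →₀ ℕ => (m + v) y ≤ N)
      (by simpa [bot_eq_zero] using hmy)
      (fun a ha b hb => ?_) fun i _ => ?_
    · rw [Finsupp.add_apply] at ha hb ⊢
      rw [Finsupp.sup_apply]
      omega
    · obtain ⟨h, hh, hhl⟩ := hlM.subset (Set.mem_range_self i)
      have := h2 h hh
      rw [← hhl, add_tsub_cancel_of_le le_sup_left, Finsupp.sup_apply]
      exact sup_le hmy this
  have hwR : m + m' ∈ FilteredComplex.dominantFace x R := by
    intro r hr hrD
    refine le_antisymm (hbound _ _ ?_ ?_) (le_trans (hrm r hr _) (Nat.le_add_right _ _))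
    · intro s hs
      by_cases hsr : s = r
      · rw [hsr]
      · exact ((hx r hrD).2 s (hDG (hR hs)) hsr).le
    · intro h hh
      exact ((hx r hrD).2 h hh.1 fun e => hh.2 (e ▸ hrD)).le
  -- At its dominant variable, `g` exceeds every element of `R` and of `G \ D`, hence also mm'.
  have hDR : ∀ g ∈ D, g ∉ R → ¬ g ≤ m + m' := by
    intro g hg hgR hle
    obtain ⟨h0, h1⟩ := hx g hg
    have := hbound (x g hg) (g (x g hg) - 1)
      (fun r hr => Nat.le_sub_one_of_lt (h1 r (hDG (hR hr)) fun e => hgR (e ▸ hr)))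
      (fun h hh => Nat.le_sub_one_of_lt (h1 h hh.1 fun e => hh.2 (e ▸ hg)))
    have := hle (x g hg)
    omega
  obtain ⟨ε, hε⟩ := h𝔾.1.isResolving
  obtain ⟨Q, εQ, hQmin, hQ, hQdeg, hQeq⟩ :=
    FilteredComplex.exists_dominantFace h𝔾.isMinimal hε hDG x hx R hR
  rw [hj] at hQ
  have hempty := hQmin.isEmpty hQ hQdeg
  have hQs := hQ.shift (hQmin.cycles_eq_top hQ hQdeg)
  obtain ⟨ε', hε'⟩ := MultigradedFreeSeq.IsResolution.isResolving
    (A := (fun h => (m ⊔ h) - m) '' (G \ D)) (F := 𝔽) h𝔽.1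
  refine ⟨fun i hi => ?_, fun i => ?_⟩
  · obtain ⟨E⟩ := hQeq i _ hwR
    have := hempty i hi
    exact E.symm.isEmpty
  · have hF := hε'.translate m
    -- Elements of `D \ R` drop out because `u` divides mm'; only generators in `G \ D` remain.
    have hJ : ∀ u ∈ FilteredComplex.dominantFace x R ∩ Set.Iic (m + m'),
        u ∈ {u | ¬ m ≤ u ∨ u - m ∈ multiples ((fun h => (m ⊔ h) - m) '' (G \ D))} ↔
          u ∈ FilteredComplex.faceMultiples G R := by
      rintro u ⟨-, huw⟩
      have hmu : m ≤ u ↔ ∀ r ∈ R, r ≤ u := by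
        rw [hm]
        exact Finset.sup_le_iff
      by_cases h : m ≤ u
      · have h' := hmu.1 h
        constructor
        · rintro (h1 | ⟨_, ⟨g, hg, rfl⟩, hgu⟩)
          · exact absurd h h1
          · refine Or.inl ⟨g, hg.1, fun hgR => hg.2 (hR hgR), ?_⟩
            have hgu' := tsub_le_iff_right.1 hgu
            rw [tsub_add_cancel_of_le h] at hgu'
            exact le_sup_right.trans hgu'
        · rintro (⟨g, hg, hgR, hgu⟩ | ⟨r, hr, hru⟩)
          · refine Or.inr ⟨_, ⟨g, ⟨hg, fun hgD => hDR g hgD hgR (hgu.trans huw)⟩, rfl⟩, ?_⟩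
            exact tsub_le_tsub_right (sup_le h hgu) m
          · exact absurd (h' r hr) hru
      · refine iff_of_true (Or.inl h) (Or.inr ?_)
        rw [hmu] at h
        push Not at h
        exact h
    obtain ⟨E⟩ := FilteredComplex.nonempty_equiv_of_isResolving (t := m + m')
      (h𝔽.isMinimal.translate m) (hQmin.shift j)
      (hF.congr (Set.subset_univ _) fun u hu => (hJ u hu).symm)
      (hQs.congr Set.inter_subset_left fun u _ => Iff.rfl)
      -- A translated degree lies between m and mm', which both have the exponent of `r` at its
      -- dominant variable, so it lies in the face.
      (fun i b hb => ⟨fun r hr hrD => le_antisymm ((hb _).trans (hwR r hr hrD).le)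
        ((hrm r hr _).trans (Nat.le_add_left _ _)), hb⟩)
      (fun i b hb => ⟨hQdeg (j + i) b, hb⟩) i
    obtain ⟨E'⟩ := hQeq (j + i) _ hwR
    rw [add_comm i j]
    refine ⟨(Equiv.subtypeEquivRight fun b => ?_).trans (E.trans E')⟩
    change 𝔽.mdeg i b = m' ↔ 𝔽.mdeg i b + m = m + m'
    rw [add_comm m m', add_left_inj]
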